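/- Let $d\ge 1$ and let $H\in\mathcal C^1(\mathbb R^d)$ be strictly convex, coercive, i.e. $\lim_{|p|\to\infty}H(p)/|p|=+\infty$, and uniformly directionally convex, i.e. for every $R>0$ $$\lambda_R:=\inf_{p\ne q\in\overline B(0,R)}\left\langle \frac{DH(p)-DH(q)}{|DH(p)-DH(q)|},\frac{p-q}{|p-q|}\right\rangle>0 .$$ Let $L(q)=\max_{p\in\mathbb R^d}\{\langle p,q\rangle-H(p)\}$ be the Legendre transform of $H$, and for $T>0$ and a Lipschitz function $\bar u:\mathbb R^d\to\mathbb R$ let $$S_T\bar u(x)=\min_{y\in\mathbb R^d}\Big\{T\,L\Big(\frac{x-y}{T}\Big)+\bar u(y)\Big\},\qquad x\in\mathbb R^d,$$ be the Hopf–Lax (viscosity) solution at time $T$ of $u_t+H(D_xu)=0$ with $u(0,\cdot)=\bar u$. For $m,M\ge 0$ put $$\mathcal U_{[m,M]}=\{\bar u:\mathbb R^d\to\mathbb R \text{ Lipschitz}:\ |\bar u(0)|\le m,\ \mathrm{Lip}[\bar u]\le M\}.$$ Then, for every $m,M\ge 0$ and every $T>0$, the set $S_T(\mathcal U_{[m,M]})=\{S_T\bar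 u:\bar u\in\mathcal U_{[m,M]}\}$ is contained in $W^{1,1}_{\mathrm{loc}}(\mathbb R^d)$ and is compact in $W^{1,1}_{\mathrm{loc}}(\mathbb R^d)$, i.e. for the topology of convergence in $W^{1,1}(B(0,R))$ for all $R>0$. -/

import Mathlib

open MeasureTheory Set Filter Topology
open scoped ContDiff NNReal Gradient

noncomputable section

/-- The quantity `λ_R`: the infimum, over all pairs of distinct points of the closed ball of
radius `R` centred at the origin, of the inner product of the unit vector in the direction of
`DH(p) - DH(q)` with the unit vector in the direction of `p - q`. -/
def directionalConvexityModulus {d : ℕ} (H : EuclideanSpace ℝ (Fin d) → ℝ) (R : ℝ) : ℝ :=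
  sInf {c : ℝ | ∃ p ∈ Metric.closedBall (0 : EuclideanSpace ℝ (Fin d)) R,
    ∃ q ∈ Metric.closedBall (0 : EuclideanSpace ℝ (Fin d)) R, p ≠ q ∧
      c = inner ℝ (‖∇ H p - ∇ H q‖⁻¹ • (∇ H p - ∇ H q)) (‖p - q‖⁻¹ • (p - q))}

/-- Uniform directional convexity: `λ_R > 0` for every `R > 0`. -/
def UniformlyDirectionallyConvex {d : ℕ} (H : EuclideanSpace ℝ (Fin d) → ℝ) : Prop :=
  ∀ R : ℝ, 0 < R → 0 < directionalConvexityModulus H R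

/-- Coercivity (superlinear growth): `H(p) / |p| → +∞` as `|p| → ∞`. -/
def Coercive {d : ℕ} (H : EuclideanSpace ℝ (Fin d) → ℝ) : Prop :=
  Tendsto (fun p => H p / ‖p‖) (cocompact (EuclideanSpace ℝ (Fin d))) atTop

/-- The Legendre transform `L(q) = sup_p (⟨p, q⟩ - H(p))`; for a continuous coercive `H` the
supremum is a maximum. -/
def legendreTransform {d : ℕ} (H : EuclideanSpace ℝ (Fin d) → ℝ)
    (q : EuclideanSpace ℝ (Fin d)) : ℝ :=
  ⨆ p : EuclideanSpace ℝ (Fin d), (inner ℝ p q - H p)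

/-- The Hopf-Lax semigroup `S_t`: `S_t u (x) = inf_y (t L((x - y) / t) + u(y))` for `t > 0`
(for a Lipschitz `u` and a convex, coercive `H` the infimum is a minimum), and `S_0 u = u`. -/
def hopfLax {d : ℕ} (H : EuclideanSpace ℝ (Fin d) → ℝ) (t : ℝ)
    (u : EuclideanSpace ℝ (Fin d) → ℝ) (x : EuclideanSpace ℝ (Fin d)) : ℝ :=
  if 0 < t then
    ⨅ y : EuclideanSpace ℝ (Fin d), (t * legendreTransform H (t⁻¹ • (x - y)) + u y)
  else u x

/-- The set `U_[m,M]` of initial data with Lipschitz constant `M` and `|u(0)| ≤ m`. -/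
def initialData (d : ℕ) (m : ℝ) (M : ℝ≥0) : Set (EuclideanSpace ℝ (Fin d) → ℝ) :=
  {u | LipschitzWith M u ∧ |u 0| ≤ m}

/-- `g` is the weak (distributional) gradient of `f` on the whole space. -/
def HasWeakGradient {d : ℕ} (f : EuclideanSpace ℝ (Fin d) → ℝ)
    (g : EuclideanSpace ℝ (Fin d) → EuclideanSpace ℝ (Fin d)) : Prop :=
  ∀ φ : EuclideanSpace ℝ (Fin d) → ℝ, ContDiff ℝ ∞ φ → HasCompactSupport φ →
    ∀ v : EuclideanSpace ℝ (Fin d),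
      ∫ x, f x * fderiv ℝ φ x v = -∫ x, φ x * inner ℝ (g x) v

/-- Membership in `W^{1,1}_loc`: `f` is locally integrable and so is its weak gradient. -/
def MemW11Loc {d : ℕ} (f : EuclideanSpace ℝ (Fin d) → ℝ) : Prop :=
  LocallyIntegrable f ∧
    ∃ g : EuclideanSpace ℝ (Fin d) → EuclideanSpace ℝ (Fin d),
      LocallyIntegrable g ∧ HasWeakGradient f g

/-- A locally integrable weak gradient is unique up to null sets. -/
theorem HasWeakGradient.ae_eq {d : ℕ} {f : EuclideanSpace ℝ (Fin d) → ℝ}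
    {g₁ g₂ : EuclideanSpace ℝ (Fin d) → EuclideanSpace ℝ (Fin d)}
    (hg₁ : LocallyIntegrable g₁) (hg₂ : LocallyIntegrable g₂)
    (h₁ : HasWeakGradient f g₁) (h₂ : HasWeakGradient f g₂) : g₁ =ᵐ[volume] g₂ := by
  have key : ∀ᵐ x ∂(volume : Measure (EuclideanSpace ℝ (Fin d))), (g₁ - g₂) x = 0 := by
    refine ae_eq_zero_of_integral_contDiff_smul_eq_zero (hg₁.sub hg₂) ?_
    intro φ hφ hc
    have i₁ : Integrable (fun x => φ x • g₁ x) :=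
      hg₁.integrable_smul_left_of_hasCompactSupport hφ.continuous hc
    have i₂ : Integrable (fun x => φ x • g₂ x) :=
      hg₂.integrable_smul_left_of_hasCompactSupport hφ.continuous hc
    have e : ∫ x, φ x • g₁ x = ∫ x, φ x • g₂ x := by
      refine ext_inner_left ℝ fun v => ?_
      rw [← integral_inner i₁, ← integral_inner i₂]
      have h := (h₁ φ hφ hc v).symm.trans (h₂ φ hφ hc v)
      simpa [inner_smul_right, real_inner_comm] using h
    have : ∫ x, φ x • (g₁ - g₂) x = ∫ x, (φ x • g₁ x - φ x • g₂ x) := by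
      simp only [Pi.sub_apply, smul_sub]
    rw [this, integral_sub i₁ i₂, e, sub_self]
  filter_upwards [key] with x hx
  exact sub_eq_zero.mp hx

/-- The space `W^{1,1}_loc(ℝ^d)` of almost-everywhere classes of functions which are locally
integrable together with their weak gradient. -/
def W11Loc (d : ℕ) : Type :=
  {f : EuclideanSpace ℝ (Fin d) →ₘ[volume] ℝ // MemW11Loc (f : EuclideanSpace ℝ (Fin d) → ℝ)}

namespace W11Loc

variable {d : ℕ}

/-- A representative of the class `f`. -/
def toFun (f : W11Loc d) : EuclideanSpace ℝ (Fin d) → ℝ := f.1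

/-- A representative of the weak gradient of `f` (which is unique up to null sets). -/
def weakGrad (f : W11Loc d) : EuclideanSpace ℝ (Fin d) → EuclideanSpace ℝ (Fin d) :=
  f.2.2.choose

theorem locallyIntegrable (f : W11Loc d) : LocallyIntegrable f.toFun := f.2.1

theorem locallyIntegrable_weakGrad (f : W11Loc d) : LocallyIntegrable f.weakGrad :=
  f.2.2.choose_spec.1

theorem hasWeakGradient (f : W11Loc d) : HasWeakGradient f.toFun f.weakGrad :=
  f.2.2.choose_spec.2

theorem integrableOn_ball {F : Type*} [NormedAddCommGroup F]
    {f : EuclideanSpace ℝ (Fin d) → F} (hf : LocallyIntegrable f) (r : ℝ) :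
    Integrable f (volume.restrict (Metric.ball 0 r)) :=
  (hf.integrableOn_isCompact (isCompact_closedBall 0 r)).mono_set Metric.ball_subset_closedBall

/-- The restriction of `f` and of its weak gradient to the ball `B(0,n)`, as a pair of elements
of `L¹(B(0,n))`: the image of the restriction of `f` under the standard embedding of
`W^{1,1}(B(0,n))` into `L¹(B(0,n)) × L¹(B(0,n))`. -/
def restrictBall (f : W11Loc d) (n : ℕ) :
    (EuclideanSpace ℝ (Fin d) →₁[volume.restrict (Metric.ball 0 (n : ℝ))] ℝ) ×
      (EuclideanSpace ℝ (Fin d) →₁[volume.restrict (Metric.ball 0 (n : ℝ))]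
        EuclideanSpace ℝ (Fin d)) :=
  ((integrableOn_ball f.locallyIntegrable n).toL1 f.toFun,
    (integrableOn_ball f.locallyIntegrable_weakGrad n).toL1 f.weakGrad)

/-- The `W^{1,1}_loc` topology: the coarsest one for which every restriction to a ball `B(0,n)`
is continuous with values in `W^{1,1}(B(0,n))`. -/
instance : TopologicalSpace (W11Loc d) :=
  TopologicalSpace.induced restrictBall inferInstance

end W11Loc

/-- The image `S_T(U_[m,M])` as a set of elements of `W^{1,1}_loc(ℝ^d)`. -/
def solutionSet {d : ℕ} (H : EuclideanSpace ℝ (Fin d) → ℝ) (T m : ℝ) (M : ℝ≥0) :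
    Set (W11Loc d) :=
  {w | ∃ u ∈ initialData d m M, w.toFun =ᵐ[volume] hopfLax H T u}

end

/-! The solution set is a continuous image of a compact set. By Arzelà–Ascoli
(`isCompact_setOf_lipschitzWith_abs_le`) the initial data are compact for locally uniform
convergence, so it suffices that `hopfLax H T` is continuous into W^{1,1}_loc.

All solutions are `M`-Lipschitz, hence differentiable a.e. Where S_T u is differentiable, with
gradient p, and y is a minimizer, p maximizes ⟨·, q⟩ - H for q = (x - y)/T; strict convexity of H
makes this maximizer unique. If u_n → u, minimizers and gradients at x stay bounded, and their limit
points are a minimizer and its maximizing momentum for u. Hence values and gradients converge a.e.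
(`tendsto_hopfLax_of_hasGradientAt`), and dominated convergence (`W11Loc.tendsto_of_ae`) concludes.
-/

/-! ### First-order convexity inequalities. -/

/-- A convex function which, along a segment, stays above a function differentiable at the
initial point with the same initial value, has increment at least that derivative. -/
theorem ConvexOn.le_sub_of_hasDerivAt_zero {V : Type*} [AddCommGroup V] [Module ℝ V] {g : V → ℝ}
    (hg : ConvexOn ℝ univ g) {r : ℝ → ℝ} {a : ℝ} (hr : HasDerivAt r a 0) {q h : V}
    (hle : ∀ t ∈ Ioo (0 : ℝ) 1, r t - r 0 ≤ g (q + t • h) - g q) :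
    a ≤ g (q + h) - g q := by
  refine le_of_tendsto hr.tendsto_slope_zero_right ?_
  filter_upwards [Ioo_mem_nhdsGT (zero_lt_one (α := ℝ))] with t ht
  have hc := hg.2 (mem_univ q) (mem_univ (q + h)) (sub_nonneg.2 ht.2.le) ht.1.le
    (sub_add_cancel 1 t)
  have he : (1 - t) • q + t • (q + h) = q + t • h := by module
  rw [he, smul_eq_mul, smul_eq_mul] at hc
  have := hle t ht
  rw [zero_add, smul_eq_mul, inv_mul_le_iff₀ ht.1]
  linarith

theorem HasGradientAt.hasDerivAt_add_smul {V : Type*} [NormedAddCommGroup V]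
    [InnerProductSpace ℝ V] [CompleteSpace V] {f : V → ℝ} {p x : V} (hf : HasGradientAt f p x)
    (h : V) : HasDerivAt (fun t : ℝ => f (x + t • h)) (inner ℝ p h) 0 := by
  have := hf.hasFDerivAt.hasLineDerivAt h
  simpa [HasLineDerivAt] using this

/-- The first-order convexity inequality. -/
theorem ConvexOn.inner_gradient_le {V : Type*} [NormedAddCommGroup V]
    [InnerProductSpace ℝ V] [CompleteSpace V] {f : V → ℝ} (hf : ConvexOn ℝ univ f) {p : V}
    (hd : DifferentiableAt ℝ f p) (p' : V) : inner ℝ (∇ f p) (p' - p) ≤ f p' - f p := by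
  have := hf.le_sub_of_hasDerivAt_zero (hd.hasGradientAt.hasDerivAt_add_smul (p' - p))
    (q := p) (h := p' - p) (fun t _ => by simp)
  simpa using this

/-! ### The Legendre transform. -/

section Legendre

variable {d : ℕ} {H : EuclideanSpace ℝ (Fin d) → ℝ}

theorem Coercive.bddAbove_range (hcoer : Coercive H) (hH : Continuous H)
    (q : EuclideanSpace ℝ (Fin d)) : BddAbove (range fun p => inner ℝ p q - H p) := by
  obtain ⟨K, hK, hKs⟩ := mem_cocompact.1 (hcoer.eventually_ge_atTop ‖q‖)
  have hc : Continuous fun p => inner ℝ p q - H p := by fun_prop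
  obtain ⟨C, hC⟩ := hK.bddAbove_image hc.continuousOn
  refine ⟨max C (max 0 (-H 0)), ?_⟩
  rintro _ ⟨p, rfl⟩
  by_cases hp : p ∈ K
  · exact (hC (mem_image_of_mem _ hp)).trans (le_max_left _ _)
  refine le_trans ?_ (le_max_right _ _)
  rcases eq_or_ne p 0 with rfl | h0
  · simp
  refine le_trans ?_ (le_max_left _ _)
  have h1 : ‖q‖ ≤ H p / ‖p‖ := hKs hp
  rw [le_div_iff₀ (norm_pos_iff.2 h0)] at h1
  linarith [real_inner_le_norm p q, mul_comm ‖p‖ ‖q‖]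

theorem le_legendreTransform (hcoer : Coercive H) (hH : Continuous H)
    (p q : EuclideanSpace ℝ (Fin d)) : inner ℝ p q - H p ≤ legendreTransform H q :=
  le_ciSup (hcoer.bddAbove_range hH q) p

theorem legendreTransform_eq {p q : EuclideanSpace ℝ (Fin d)}
    (h : ∀ p', inner ℝ p' q - H p' ≤ inner ℝ p q - H p) :
    legendreTransform H q = inner ℝ p q - H p :=
  le_antisymm (ciSup_le h) (le_ciSup (f := fun p => inner ℝ p q - H p)
    ⟨_, forall_mem_range.2 h⟩ p)

theorem convexOn_legendreTransform (hcoer : Coercive H) (hH : Continuous H) :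
    ConvexOn ℝ univ (legendreTransform H) := by
  refine ⟨convex_univ, fun x _ y _ a b ha hb hab => ciSup_le fun p => ?_⟩
  have h1 := mul_le_mul_of_nonneg_left (le_legendreTransform hcoer hH p x) ha
  have h2 := mul_le_mul_of_nonneg_left (le_legendreTransform hcoer hH p y) hb
  rw [inner_add_right, inner_smul_right, inner_smul_right, smul_eq_mul, smul_eq_mul]
  have : H p = a * H p + b * H p := by rw [← add_mul, hab, one_mul]
  linarith

theorem lowerSemicontinuous_legendreTransform (hcoer : Coercive H) (hH : Continuous H) :
    LowerSemicontinuous (legendreTransform H) :=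
  lowerSemicontinuous_ciSup (hcoer.bddAbove_range hH) fun p =>
    Continuous.lowerSemicontinuous (by fun_prop)

/-- The Legendre transform grows faster than any multiple of the norm. -/
theorem exists_mul_norm_sub_le_legendreTransform (hcoer : Coercive H) (hH : Continuous H) {A : ℝ}
    (hA : 0 ≤ A) : ∃ C, ∀ q, A * ‖q‖ - C ≤ legendreTransform H q := by
  obtain ⟨C, hC⟩ := (isCompact_closedBall (0 : EuclideanSpace ℝ (Fin d)) A).bddAbove_image
    hH.continuousOn
  refine ⟨C, fun q => ?_⟩
  -- The test momentum is A q/|q|, which is 0 when q = 0 because `0⁻¹ = 0`.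
  have hp : (A * ‖q‖⁻¹) • q ∈ Metric.closedBall (0 : EuclideanSpace ℝ (Fin d)) A := by
    rw [mem_closedBall_zero_iff, norm_smul, Real.norm_of_nonneg (by positivity), mul_assoc]
    exact mul_le_of_le_one_right hA inv_mul_le_one
  have h1 := hC (mem_image_of_mem H hp)
  have h2 := le_legendreTransform hcoer hH ((A * ‖q‖⁻¹) • q) q
  rw [real_inner_smul_left, real_inner_self_eq_norm_sq] at h2
  have h3 : A * ‖q‖⁻¹ * ‖q‖ ^ 2 = A * ‖q‖ := by
    rcases eq_or_ne ‖q‖ 0 with h | h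
    · simp [h]
    · field_simp
  linarith

/-- A subgradient of the Legendre transform at `q` realizes the maximum defining it. -/
theorem le_inner_sub_of_subgradient_legendreTransform (hcoer : Coercive H) (hd : Differentiable ℝ H)
    (hconv : ConvexOn ℝ univ H) {p q : EuclideanSpace ℝ (Fin d)}
    (h : ∀ v, inner ℝ p v ≤ legendreTransform H (q + v) - legendreTransform H q)
    (p' : EuclideanSpace ℝ (Fin d)) : inner ℝ p' q - H p' ≤ inner ℝ p q - H p := by
  -- L is explicit at DH(p); the subgradient inequality tested there gives L(q) ≤ ⟨p, q⟩ - H(p),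
  -- without biduality.
  have h1 : legendreTransform H (∇ H p) = inner ℝ p (∇ H p) - H p :=
    legendreTransform_eq fun p' => by
      have := hconv.inner_gradient_le (hd p) p'
      rw [inner_sub_right, real_inner_comm p', real_inner_comm p] at this
      linarith
  have h2 := h (∇ H p - q)
  rw [add_sub_cancel, h1, inner_sub_right] at h2
  linarith [le_legendreTransform hcoer hd.continuous p' q]

/-- The midpoint of two distinct maximizers would do strictly better. -/
theorem eq_of_forall_inner_sub_le (hconv : StrictConvexOn ℝ univ H)
    {p₁ p₂ q : EuclideanSpace ℝ (Fin d)}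
    (h₁ : ∀ p', inner ℝ p' q - H p' ≤ inner ℝ p₁ q - H p₁)
    (h₂ : ∀ p', inner ℝ p' q - H p' ≤ inner ℝ p₂ q - H p₂) : p₁ = p₂ := by
  by_contra hne
  have h := hconv.2 (mem_univ p₁) (mem_univ p₂) hne one_half_pos one_half_pos (add_halves 1)
  have h3 := h₁ ((1 / 2 : ℝ) • p₁ + (1 / 2 : ℝ) • p₂)
  rw [inner_add_left, real_inner_smul_left, real_inner_smul_left] at h3
  rw [smul_eq_mul, smul_eq_mul] at h
  linarith [h₂ p₁]

end Legendre

/-! ### Minimizers and gradients of the Hopf–Lax formula. -/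

section HopfLax

variable {d : ℕ} {H u : EuclideanSpace ℝ (Fin d) → ℝ} {T : ℝ} {M : ℝ≥0}

theorem exists_norm_sub_le_hopfLax_integrand (hcoer : Coercive H) (hH : Continuous H) (hT : 0 < T)
    (M : ℝ≥0) : ∃ C, ∀ u : EuclideanSpace ℝ (Fin d) → ℝ, LipschitzWith M u → ∀ x y,
      ‖x - y‖ + u x - C ≤ T * legendreTransform H (T⁻¹ • (x - y)) + u y := by
  -- Of the slope M + 1, M absorbs the variation of u; the remaining 1 confines minimizers,
  -- uniformly in u and x.
  obtain ⟨C, hC⟩ := exists_mul_norm_sub_le_legendreTransform hcoer hH (A := M + 1) (by positivity)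
  refine ⟨T * C, fun u hu x y => ?_⟩
  have h1 := mul_le_mul_of_nonneg_left (hC (T⁻¹ • (x - y))) hT.le
  rw [norm_smul, Real.norm_of_nonneg (inv_nonneg.2 hT.le)] at h1
  have h2 := hu.le_add_mul x y
  rw [dist_eq_norm] at h2
  have h3 : T * ((M + 1) * (T⁻¹ * ‖x - y‖) - C) = (M + 1) * ‖x - y‖ - T * C := by
    field_simp
  linarith

theorem bddBelow_range_hopfLax_integrand (hcoer : Coercive H) (hH : Continuous H) (hT : 0 < T)
    (hu : LipschitzWith M u) (x : EuclideanSpace ℝ (Fin d)) :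
    BddBelow (range fun y => T * legendreTransform H (T⁻¹ • (x - y)) + u y) := by
  obtain ⟨C, hC⟩ := exists_norm_sub_le_hopfLax_integrand hcoer hH hT M
  refine ⟨u x - C, ?_⟩
  rintro _ ⟨y, rfl⟩
  linarith [hC u hu x y, norm_nonneg (x - y)]

theorem hopfLax_le (hcoer : Coercive H) (hH : Continuous H) (hT : 0 < T)
    (hu : LipschitzWith M u) (x y : EuclideanSpace ℝ (Fin d)) :
    hopfLax H T u x ≤ T * legendreTransform H (T⁻¹ • (x - y)) + u y := by
  rw [hopfLax, if_pos hT]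
  exact ciInf_le (bddBelow_range_hopfLax_integrand hcoer hH hT hu x) y

theorem lipschitzWith_hopfLax (hcoer : Coercive H) (hH : Continuous H) (hT : 0 < T)
    (hu : LipschitzWith M u) : LipschitzWith M (hopfLax H T u) := by
  refine LipschitzWith.of_le_add_mul M fun x x' => ?_
  rw [← sub_le_iff_le_add]
  conv_rhs => rw [hopfLax, if_pos hT]
  refine le_ciInf fun y => ?_
  -- Translating the competitor along with x leaves the velocity unchanged.
  have h1 := hopfLax_le hcoer hH hT hu x (y + (x - x'))
  have h2 := hu.le_add_mul (y + (x - x')) y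
  rw [dist_eq_norm, add_sub_cancel_left, ← dist_eq_norm] at h2
  rw [show x - (y + (x - x')) = x' - y by abel] at h1
  linarith

theorem exists_hopfLax_eq (hcoer : Coercive H) (hH : Continuous H) (hT : 0 < T)
    (hu : LipschitzWith M u) (x : EuclideanSpace ℝ (Fin d)) :
    ∃ y, hopfLax H T u x = T * legendreTransform H (T⁻¹ • (x - y)) + u y := by
  obtain ⟨C, hC⟩ := exists_norm_sub_le_hopfLax_integrand hcoer hH hT M
  set F := fun y => T * legendreTransform H (T⁻¹ • (x - y)) + u y with hF
  have hlsc : LowerSemicontinuous F := by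
    have h1 : LowerSemicontinuous fun y => legendreTransform H (T⁻¹ • (x - y)) :=
      (lowerSemicontinuous_legendreTransform hcoer hH).comp (by fun_prop)
    have h2 : LowerSemicontinuous fun y => T * legendreTransform H (T⁻¹ • (x - y)) :=
      (by fun_prop : Continuous fun s : ℝ => T * s).comp_lowerSemicontinuous h1
        fun a b hab => mul_le_mul_of_nonneg_left hab hT.le
    exact h2.add hu.continuous.lowerSemicontinuous
  have hball : ∀ y, F y ≤ F x → y ∈ Metric.closedBall x (F x - u x + C) := fun y hy => by
    rw [mem_closedBall_iff_norm']
    linarith [hC u hu x y]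
  obtain ⟨y, -, hmin⟩ := (hlsc.lowerSemicontinuousOn _).exists_isMinOn
    ⟨x, hball x le_rfl⟩ (isCompact_closedBall x (F x - u x + C))
  refine ⟨y, le_antisymm (hopfLax_le hcoer hH hT hu x y) ?_⟩
  rw [hopfLax, if_pos hT]
  refine le_ciInf fun z => ?_
  rcases le_total (F z) (F x) with h | h
  · exact hmin (hball z h)
  · exact (hmin (hball x le_rfl)).trans h

theorem exists_abs_hopfLax_sub_le (hcoer : Coercive H) (hH : Continuous H) (hT : 0 < T) (M : ℝ≥0) :
    ∃ C, ∀ u : EuclideanSpace ℝ (Fin d) → ℝ, LipschitzWith M u → ∀ x,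
      |hopfLax H T u x - u x| ≤ C ∧ ∀ y,
      hopfLax H T u x = T * legendreTransform H (T⁻¹ • (x - y)) + u y → ‖x - y‖ ≤ C := by
  obtain ⟨C, hC⟩ := exists_norm_sub_le_hopfLax_integrand hcoer hH hT M
  refine ⟨|T * legendreTransform H 0| + |C|, fun u hu x => ?_⟩
  have h1 := hopfLax_le hcoer hH hT hu x x
  rw [sub_self, smul_zero] at h1
  have h2 := le_abs_self (T * legendreTransform H 0)
  have h3 := le_abs_self C
  refine ⟨?_, fun y hy => by linarith [hC u hu x y]⟩
  obtain ⟨y, hy⟩ := exists_hopfLax_eq hcoer hH hT hu x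
  rw [abs_le]
  constructor <;> linarith [hC u hu x y, norm_nonneg (x - y), abs_nonneg C,
    abs_nonneg (T * legendreTransform H 0)]

/-- At a differentiability point, the gradient of the Hopf-Lax solution is the optimal momentum
for the velocity of any optimal trajectory. -/
theorem HasGradientAt.le_inner_sub_of_hopfLax_eq (hcoer : Coercive H) (hd : Differentiable ℝ H)
    (hconv : ConvexOn ℝ univ H) (hT : 0 < T) (hu : LipschitzWith M u)
    {p x y : EuclideanSpace ℝ (Fin d)}
    (hp : HasGradientAt (hopfLax H T u) p x)
    (hy : hopfLax H T u x = T * legendreTransform H (T⁻¹ • (x - y)) + u y)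
    (p' : EuclideanSpace ℝ (Fin d)) :
    inner ℝ p' (T⁻¹ • (x - y)) - H p' ≤ inner ℝ p (T⁻¹ • (x - y)) - H p := by
  refine le_inner_sub_of_subgradient_legendreTransform hcoer hd hconv (fun v => ?_) p'
  -- With y frozen, the formula bounds S_T u(x + tTv) by T L(q + tv) + u(y), with equality at t = 0;
  -- hence p is a subgradient of L at q.
  have hder := (hp.hasDerivAt_add_smul (T • v)).const_mul T⁻¹
  rw [real_inner_smul_right, inv_mul_cancel_left₀ hT.ne'] at hder
  refine (convexOn_legendreTransform hcoer hd.continuous).le_sub_of_hasDerivAt_zero hder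
    fun t _ => ?_
  have h1 := hopfLax_le hcoer hd.continuous hT hu (x + t • T • v) y
  have h2 : T⁻¹ • (x + t • T • v - y) = T⁻¹ • (x - y) + t • v := by
    rw [add_sub_right_comm, smul_add, smul_comm t T, inv_smul_smul₀ hT.ne']
  rw [h2] at h1
  simp only [zero_smul, add_zero]
  rw [← mul_sub, inv_mul_le_iff₀ hT]
  linarith

end HopfLax

/-! ### Pointwise stability of values and gradients. -/

theorem HasGradientAt.norm_le_of_lipschitzWith {V : Type*} [NormedAddCommGroup V]
    [InnerProductSpace ℝ V] [CompleteSpace V] {f : V → ℝ} {p x : V} {K : ℝ≥0}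
    (hf : HasGradientAt f p x) (hK : LipschitzWith K f) : ‖p‖ ≤ K := by
  simpa using hf.hasFDerivAt.le_of_lipschitz hK

/-- No differentiability is required: `∇ f x` is 0 by default elsewhere. -/
theorem LipschitzWith.norm_gradient_le {V : Type*} [NormedAddCommGroup V]
    [InnerProductSpace ℝ V] [CompleteSpace V] {f : V → ℝ} {K : ℝ≥0}
    (hK : LipschitzWith K f) (x : V) : ‖∇ f x‖ ≤ K := by
  simpa [gradient] using norm_fderiv_le_of_lipschitz ℝ hK

/-- Pointwise convergence of equi-Lipschitz initial data implies convergence of the Hopf-Lax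
solutions and of their gradients at every point of common differentiability. -/
theorem tendsto_hopfLax_of_hasGradientAt {d : ℕ} {H : EuclideanSpace ℝ (Fin d) → ℝ} {T : ℝ}
    {M : ℝ≥0} (hcoer : Coercive H) (hd : Differentiable ℝ H)
    (hconv : StrictConvexOn ℝ univ H) (hT : 0 < T)
    {u : ℕ → EuclideanSpace ℝ (Fin d) → ℝ} {u₀ : EuclideanSpace ℝ (Fin d) → ℝ}
    (hu : ∀ n, LipschitzWith M (u n)) (hu₀ : LipschitzWith M u₀)
    (hlim : ∀ y, Tendsto (fun n => u n y) atTop (𝓝 (u₀ y)))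
    {p : ℕ → EuclideanSpace ℝ (Fin d)} {p₀ x : EuclideanSpace ℝ (Fin d)}
    (hp : ∀ n, HasGradientAt (hopfLax H T (u n)) (p n) x)
    (hp₀ : HasGradientAt (hopfLax H T u₀) p₀ x) :
    Tendsto (fun n => (hopfLax H T (u n) x, p n)) atTop (𝓝 (hopfLax H T u₀ x, p₀)) := by
  have hH := hd.continuous
  obtain ⟨C, hC⟩ := exists_abs_hopfLax_sub_le hcoer hH hT M
  choose y hy using fun n => exists_hopfLax_eq hcoer hH hT (hu n) x
  refine tendsto_of_subseq_tendsto fun ns hns => ?_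
  have hbdd : Bornology.IsBounded (Metric.closedBall x C ×ˢ
      Metric.closedBall (0 : EuclideanSpace ℝ (Fin d)) M) :=
    Metric.isBounded_closedBall.prod Metric.isBounded_closedBall
  obtain ⟨⟨a, b⟩, -, φ, hφ, hab⟩ := tendsto_subseq_of_bounded hbdd
    (x := fun k => (y (ns k), p (ns k))) fun k =>
      ⟨mem_closedBall_iff_norm'.2 ((hC _ (hu (ns k)) x).2 _ (hy _)),
        mem_closedBall_zero_iff.2 ((hp (ns k)).norm_le_of_lipschitzWith
          (lipschitzWith_hopfLax hcoer hH hT (hu _)))⟩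
  refine ⟨φ, ?_⟩
  have hn : Tendsto (fun k => ns (φ k)) atTop atTop := hns.comp hφ.tendsto_atTop
  have ha : Tendsto (fun k => y (ns (φ k))) atTop (𝓝 a) := hab.fst_nhds
  have hb : Tendsto (fun k => p (ns (φ k))) atTop (𝓝 b) := hab.snd_nhds
  have hq : Tendsto (fun k => T⁻¹ • (x - y (ns (φ k)))) atTop (𝓝 (T⁻¹ • (x - a))) :=
    (ha.const_sub x).const_smul T⁻¹
  have hval : Tendsto (fun k => inner ℝ (p (ns (φ k))) (T⁻¹ • (x - y (ns (φ k))))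
      - H (p (ns (φ k)))) atTop (𝓝 (inner ℝ b (T⁻¹ • (x - a)) - H b)) :=
    (hb.inner hq).sub ((hH.tendsto b).comp hb)
  have hopt : ∀ n p', inner ℝ p' (T⁻¹ • (x - y n)) - H p' ≤
      inner ℝ (p n) (T⁻¹ • (x - y n)) - H (p n) := fun n =>
    (hp n).le_inner_sub_of_hopfLax_eq hcoer hd hconv.convexOn hT (hu n) (hy n)
  have hbmax : ∀ p', inner ℝ p' (T⁻¹ • (x - a)) - H p' ≤ inner ℝ b (T⁻¹ • (x - a)) - H b :=
    fun p' => le_of_tendsto_of_tendsto' ((tendsto_const_nhds.inner hq).sub_const (H p')) hval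
      fun k => hopt _ p'
  have hua : Tendsto (fun k => u (ns (φ k)) (y (ns (φ k)))) atTop (𝓝 (u₀ a)) := by
    have h0 : Tendsto (fun k => (M : ℝ) * dist (y (ns (φ k))) a) atTop (𝓝 0) := by
      simpa using (tendsto_iff_dist_tendsto_zero.1 ha).const_mul (M : ℝ)
    refine ((hlim a).comp hn).congr_dist (squeeze_zero (fun _ => dist_nonneg) (fun k => ?_) h0)
    rw [dist_comm]
    exact (hu _).dist_le_mul _ _
  -- Continuity of L is not invoked: the optimal momenta express L(q_k) as ⟨p_k, q_k⟩ - H(p_k),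
  -- which converges.
  have hV : Tendsto (fun k => hopfLax H T (u (ns (φ k))) x) atTop
      (𝓝 (T * legendreTransform H (T⁻¹ • (x - a)) + u₀ a)) := by
    rw [legendreTransform_eq hbmax]
    refine ((hval.const_mul T).add hua).congr fun k => ?_
    rw [hy, legendreTransform_eq (hopt _)]
  have hmin : hopfLax H T u₀ x = T * legendreTransform H (T⁻¹ • (x - a)) + u₀ a := by
    refine le_antisymm (hopfLax_le hcoer hH hT hu₀ x a) ?_
    rw [hopfLax, if_pos hT]
    exact le_ciInf fun z => le_of_tendsto_of_tendsto' hV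
      (((hlim z).comp hn).const_add _) fun k => hopfLax_le hcoer hH hT (hu _) x z
  have hpb : p₀ = b := eq_of_forall_inner_sub_le hconv
    (hp₀.le_inner_sub_of_hopfLax_eq hcoer hd hconv.convexOn hT hu₀ hmin) hbmax
  rw [hmin, hpb]
  exact hV.prodMk_nhds hb

/-! ### Lipschitz functions and convergence in W^{1,1}_loc. -/

/-- The almost-everywhere gradient of a Lipschitz function is its weak gradient. -/
theorem LipschitzWith.hasWeakGradient {d : ℕ} {f : EuclideanSpace ℝ (Fin d) → ℝ} {K : ℝ≥0}
    (hf : LipschitzWith K f) : HasWeakGradient f (∇ f) := by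
  intro φ hφ hc v
  obtain ⟨C, hC⟩ := hφ.lipschitzWith_of_hasCompactSupport hc (by simp)
  have h := integral_lineDeriv_mul_eq (μ := volume) hf hC hc v
  have h1 : ∫ x, lineDeriv ℝ f x v * φ x = ∫ x, φ x * inner ℝ (∇ f x) v := by
    refine integral_congr_ae ?_
    filter_upwards [hf.ae_differentiableAt] with x hx
    rw [hx.lineDeriv_eq_fderiv, gradient, InnerProductSpace.toDual_symm_apply, mul_comm]
  have h2 : ∫ x, lineDeriv ℝ φ x (-v) * f x = -∫ x, f x * fderiv ℝ φ x v := by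
    rw [← integral_neg]
    refine integral_congr_ae (.of_forall fun x => ?_)
    simp only [(hφ.differentiable (by simp) x).lineDeriv_eq_fderiv, map_neg]
    ring
  rw [← h1, h, h2, neg_neg]

theorem measurable_gradient {V : Type*} [NormedAddCommGroup V] [InnerProductSpace ℝ V]
    [CompleteSpace V] [MeasurableSpace V] [BorelSpace V] [FiniteDimensional ℝ V] (f : V → ℝ) :
    Measurable (∇ f) :=
  (InnerProductSpace.toDual ℝ V).symm.continuous.measurable.comp (measurable_fderiv ℝ f)

theorem LipschitzWith.locallyIntegrable_gradient {d : ℕ} {f : EuclideanSpace ℝ (Fin d) → ℝ}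
    {K : ℝ≥0} (hf : LipschitzWith K f) : LocallyIntegrable (∇ f) :=
  (continuous_const (y := (K : ℝ))).locallyIntegrable.mono
    (measurable_gradient f).aestronglyMeasurable
    (.of_forall fun x => (hf.norm_gradient_le x).trans (Real.le_norm_self _))

theorem LipschitzWith.memW11Loc {d : ℕ} {f : EuclideanSpace ℝ (Fin d) → ℝ} {K : ℝ≥0}
    (hf : LipschitzWith K f) : MemW11Loc f :=
  ⟨hf.continuous.locallyIntegrable, ∇ f, hf.locallyIntegrable_gradient, hf.hasWeakGradient⟩

theorem HasWeakGradient.congr_ae {d : ℕ} {f f' : EuclideanSpace ℝ (Fin d) → ℝ}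
    {g : EuclideanSpace ℝ (Fin d) → EuclideanSpace ℝ (Fin d)} (h : HasWeakGradient f g)
    (hff' : f =ᵐ[volume] f') : HasWeakGradient f' g := fun φ hφ hc v => by
  rw [← h φ hφ hc v]
  refine integral_congr_ae ?_
  filter_upwards [hff'] with x hx
  rw [hx]

theorem MemW11Loc.congr_ae {d : ℕ} {f f' : EuclideanSpace ℝ (Fin d) → ℝ} (h : MemW11Loc f)
    (hff' : f =ᵐ[volume] f') : MemW11Loc f' := by
  obtain ⟨hf, g, hg, hfg⟩ := h
  exact ⟨(locallyIntegrable_congr hff').1 hf, g, hg, hfg.congr_ae hff'⟩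

namespace W11Loc

variable {d : ℕ}

/-- The class of a Lipschitz function. -/
noncomputable def ofLipschitz (f : EuclideanSpace ℝ (Fin d) → ℝ) {K : ℝ≥0}
    (hf : LipschitzWith K f) : W11Loc d :=
  ⟨AEEqFun.mk f hf.continuous.aestronglyMeasurable,
    hf.memW11Loc.congr_ae (AEEqFun.coeFn_mk f _).symm⟩

theorem toFun_ofLipschitz {f : EuclideanSpace ℝ (Fin d) → ℝ} {K : ℝ≥0} (hf : LipschitzWith K f) :
    (ofLipschitz f hf).toFun =ᵐ[volume] f :=
  AEEqFun.coeFn_mk f _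

theorem weakGrad_ofLipschitz {f : EuclideanSpace ℝ (Fin d) → ℝ} {K : ℝ≥0}
    (hf : LipschitzWith K f) : (ofLipschitz f hf).weakGrad =ᵐ[volume] ∇ f :=
  HasWeakGradient.ae_eq (locallyIntegrable_weakGrad _) hf.locallyIntegrable_gradient
    (hasWeakGradient _) (hf.hasWeakGradient.congr_ae (toFun_ofLipschitz hf).symm)

theorem ext_ae {f g : W11Loc d} (h : f.toFun =ᵐ[volume] g.toFun) : f = g :=
  Subtype.ext (AEEqFun.ext h)

/-- Dominated convergence in `W^{1,1}_loc`. -/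
theorem tendsto_of_ae {F : ℕ → W11Loc d} {F₀ : W11Loc d} {b : EuclideanSpace ℝ (Fin d) → ℝ}
    (hb : Continuous b)
    (hbF : ∀ n, ∀ᵐ x, ‖(F n).toFun x‖ ≤ b x) (hbG : ∀ n, ∀ᵐ x, ‖(F n).weakGrad x‖ ≤ b x)
    (hF : ∀ᵐ x, Tendsto (fun n => (F n).toFun x) atTop (𝓝 (F₀.toFun x)))
    (hG : ∀ᵐ x, Tendsto (fun n => (F n).weakGrad x) atTop (𝓝 (F₀.weakGrad x))) :
    Tendsto F atTop (𝓝 F₀) := by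
  have key : ∀ {V : Type} [NormedAddCommGroup V] {f : ℕ → EuclideanSpace ℝ (Fin d) → V}
      {f₀ : EuclideanSpace ℝ (Fin d) → V} (hf : ∀ n, LocallyIntegrable (f n))
      (hf₀ : LocallyIntegrable f₀) (_ : ∀ n, ∀ᵐ x, ‖f n x‖ ≤ b x)
      (_ : ∀ᵐ x, Tendsto (fun n => f n x) atTop (𝓝 (f₀ x))) (k : ℕ),
      Tendsto (fun n => (integrableOn_ball (hf n) k).toL1 (f n)) atTop
        (𝓝 ((integrableOn_ball hf₀ k).toL1 f₀)) := by
    intro V _ f f₀ hf hf₀ hbd hlim k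
    rw [tendsto_iff_edist_tendsto_0]
    simp_rw [Integrable.edist_toL1_toL1, edist_dist, dist_eq_norm]
    exact tendsto_lintegral_norm_of_dominated_convergence
      (fun n => (integrableOn_ball (hf n) k).aestronglyMeasurable)
      (integrableOn_ball hb.locallyIntegrable k).hasFiniteIntegral
      (fun n => ae_restrict_of_ae (hbd n)) (ae_restrict_of_ae hlim)
  rw [nhds_induced, tendsto_comap_iff, tendsto_pi_nhds]
  exact fun k => (key (fun n => (F n).locallyIntegrable) F₀.locallyIntegrable hbF hF k).prodMk_nhds
    (key (fun n => (F n).locallyIntegrable_weakGrad) F₀.locallyIntegrable_weakGrad hbG hG k)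

end W11Loc

/-! ### Compactness of the data and conclusion. -/

theorem isCompact_setOf_lipschitzWith_abs_le {V : Type*} [PseudoMetricSpace V] (x₀ : V) (M : ℝ≥0)
    (m : ℝ) : IsCompact {f : C(V, ℝ) | LipschitzWith M f ∧ |f x₀| ≤ m} := by
  refine ArzelaAscoli.isCompact_of_equicontinuous _ ?_
    (LipschitzWith.uniformEquicontinuous _ M fun f => f.2.1).equicontinuous
  have himg : ContinuousMap.toFun '' {f : C(V, ℝ) | LipschitzWith M f ∧ |f x₀| ≤ m} =
      {f : V → ℝ | LipschitzWith M f ∧ |f x₀| ≤ m} := by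
    ext f
    exact ⟨by rintro ⟨g, hg, rfl⟩; exact hg, fun hf => ⟨⟨f, hf.1.continuous⟩, hf, rfl⟩⟩
  rw [himg]
  -- Pointwise compactness is Tychonoff: the set is closed in a product of intervals.
  refine (isCompact_univ_pi fun x => isCompact_Icc (a := -(m + M * dist x x₀))
    (b := m + M * dist x x₀)).of_isClosed_subset ?_ fun f hf x _ => ?_
  · simp only [lipschitzWith_iff_dist_le_mul, Set.ofPred_and, Set.ofPred_forall]
    exact (isClosed_iInter fun x => isClosed_iInter fun y =>
      isClosed_le (by fun_prop) (by fun_prop)).inter (isClosed_le (by fun_prop) (by fun_prop))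
  · have h1 := hf.1.dist_le_mul x x₀
    rw [Real.dist_eq, abs_le] at h1
    have h2 := abs_le.1 hf.2
    constructor <;> linarith

theorem mainTheorem2 {d : ℕ} (hd : 0 < d) (H : EuclideanSpace ℝ (Fin d) → ℝ)
    (hC1 : ContDiff ℝ 1 H) (hconv : StrictConvexOn ℝ Set.univ H) (hcoer : Coercive H)
    (hudc : UniformlyDirectionallyConvex H)
    (m : ℝ) (hm : 0 ≤ m) (M : ℝ≥0) (T : ℝ) (hT : 0 < T) :
    (∀ u ∈ initialData d m M, MemW11Loc (hopfLax H T u)) ∧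
      IsCompact (solutionSet H T m M) := by
  have hdiff : Differentiable ℝ H := hC1.differentiable one_ne_zero
  have hH := hdiff.continuous
  have hlip {u : EuclideanSpace ℝ (Fin d) → ℝ} (hu : LipschitzWith M u) :
      LipschitzWith M (hopfLax H T u) := lipschitzWith_hopfLax hcoer hH hT hu
  refine ⟨fun u hu => (hlip hu.1).memW11Loc, ?_⟩
  set K := {f : C(EuclideanSpace ℝ (Fin d), ℝ) | LipschitzWith M f ∧ |f 0| ≤ m}
  have hK : CompactSpace K :=
    isCompact_iff_compactSpace.1 (isCompact_setOf_lipschitzWith_abs_le 0 M m)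
  let Φ : K → W11Loc d := fun f => W11Loc.ofLipschitz _ (hlip f.2.1)
  have hrange : solutionSet H T m M = range Φ := by
    ext w
    constructor
    · rintro ⟨u, hu, hw⟩
      exact ⟨⟨⟨u, hu.1.continuous⟩, hu⟩,
        W11Loc.ext_ae ((W11Loc.toFun_ofLipschitz (hlip hu.1)).trans hw.symm)⟩
    · rintro ⟨f, rfl⟩
      exact ⟨f.1, f.2, W11Loc.toFun_ofLipschitz _⟩
  rw [hrange]
  -- Sequences suffice on `K`, as ℝ^d is locally compact and σ-compact; dominated convergence then
  -- applies.
  refine isCompact_range (continuous_iff_seqContinuous.2 fun f f₀ hf => ?_)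
  obtain ⟨C, hC⟩ := exists_abs_hopfLax_sub_le hcoer hH hT M
  have hbound (u : EuclideanSpace ℝ (Fin d) → ℝ) (hu : u ∈ initialData d m M) (x) :
      ‖hopfLax H T u x‖ ≤ C + m + M * ‖x‖ := by
    have h1 := abs_le.1 (hC u hu.1 x).1
    have h2 := abs_le.1 hu.2
    have h3 := hu.1.dist_le_mul x 0
    rw [Real.dist_eq, dist_zero_right, abs_le] at h3
    rw [Real.norm_eq_abs, abs_le]
    constructor <;> linarith
  have hlim (y) : Tendsto (fun n => (f n).1 y) atTop (𝓝 (f₀.1 y)) :=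
    ((continuous_eval_const y).comp continuous_subtype_val).continuousAt.tendsto.comp hf
  have hae : ∀ᵐ x, Tendsto (fun n => (hopfLax H T (f n).1 x, ∇ (hopfLax H T (f n).1) x)) atTop
      (𝓝 (hopfLax H T f₀.1 x, ∇ (hopfLax H T f₀.1) x)) := by
    filter_upwards [ae_all_iff.2 fun n => (hlip (f n).2.1).ae_differentiableAt,
      (hlip f₀.2.1).ae_differentiableAt] with x hx hx₀
    exact tendsto_hopfLax_of_hasGradientAt hcoer hdiff hconv hT (fun n => (f n).2.1) f₀.2.1 hlim
      (fun n => (hx n).hasGradientAt) hx₀.hasGradientAt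
  have hF (g : K) : (Φ g).toFun =ᵐ[volume] hopfLax H T g.1 :=
    W11Loc.toFun_ofLipschitz (hlip g.2.1)
  have hG (g : K) : (Φ g).weakGrad =ᵐ[volume] ∇ (hopfLax H T g.1) :=
    W11Loc.weakGrad_ofLipschitz (hlip g.2.1)
  -- One function dominates both: the first three terms bound the values, the last the gradients.
  refine W11Loc.tendsto_of_ae (b := fun x => |C| + m + M * ‖x‖ + M) (by fun_prop)
    (fun n => ?_) (fun n => ?_) ?_ ?_
  · filter_upwards [hF (f n)] with x hx
    rw [Function.comp_apply, hx]
    linarith [hbound _ (f n).2 x, le_abs_self C, M.2]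
  · filter_upwards [hG (f n)] with x hx
    rw [Function.comp_apply, hx]
    have h1 := (hlip (f n).2.1).norm_gradient_le x
    have h2 : 0 ≤ |C| + m + M * ‖x‖ := by positivity
    linarith
  · filter_upwards [hae, ae_all_iff.2 fun n => hF (f n), hF f₀] with x hx hn h₀
    rw [h₀]
    exact hx.fst_nhds.congr fun n => (hn n).symm
  · filter_upwards [hae, ae_all_iff.2 fun n => hG (f n), hG f₀] with x hx hn h₀
    rw [h₀]
    exact hx.snd_nhds.congr fun n => (hn n).symm
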